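/- Equip $\mathbb{R}^4$, with coordinates $(x_1,y_1,x_2,y_2)$, with the standard symplectic form $\omega = dx_1\wedge dy_1 + dx_2\wedge dy_2$. For $r>0$ let $S^3(r)$ be the Euclidean sphere of radius $r$ centred at $0$. An open inner (resp. outer) neighbourhood of $S^3(r)$ is a set $N\cap\{|x|<r\}$ (resp. $N\cap\{|x|>r\}$), where $N\subset\mathbb{R}^4$ is open and contains $S^3(r)$; a one-sided neighbourhood is an inner or an outer one. A symplectomorphism $g:V\to W$ between open subsets of $\mathbb{R}^4$ is a $C^\infty$ diffeomorphism of $V$ onto $W$ with $g^*\omega=\omega$. Let $r,R>0$. Then: (1) there exist an open inner neighbourhood $V$ of $S^3(r)$, an open inner neighbourhood $W$ of $S^3(R)$ and a symplectomorphism $g:V\to W$ if and only if $r=R$; (2) there exist an open one-sided neighbourhood $V$ of $S^3(r)$, an open one-sided neighbourhood $W$ of $S^3(R)$ (each of them inner or outer) and a symplectomorphism $g:V\to W$ such that $g(x)$ tends to $S^3(R)$ whenever $x\in V$ tends to $S^3(r)$ (that is, every neighbourhood of $S^3(R)$ contains $g(V\cap M)$ for some neighbourhood $M$ of $S^3(r)$)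 if and only if $r=R$. -/

import Mathlib

open Set Filter Topology
open scoped ContDiff

namespace SphereCollar

/-- Euclidean space `ℝ⁴`, with coordinates ordered as `(x₁, y₁, x₂, y₂)`. -/
abbrev R4 : Type := EuclideanSpace ℝ (Fin 4)

/-- The standard symplectic form `ω = dx₁ ∧ dy₁ + dx₂ ∧ dy₂` on `ℝ⁴`. -/
def omega (u v : R4) : ℝ :=
  (u 0 * v 1 - u 1 * v 0) + (u 2 * v 3 - u 3 * v 2)

/-- `V` is an open inner neighbourhood of the sphere `S³(r)`: the trace on the open ball `B⁴(r)` of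
an open neighbourhood of the sphere in `ℝ⁴`. -/
def IsInnerNeighbourhood (r : ℝ) (V : Set R4) : Prop :=
  ∃ N : Set R4, IsOpen N ∧ Metric.sphere (0 : R4) r ⊆ N ∧ V = N ∩ Metric.ball 0 r

/-- `V` is an open outer neighbourhood of the sphere `S³(r)`: the trace on the exterior of the
closed ball of an open neighbourhood of the sphere in `ℝ⁴`. -/
def IsOuterNeighbourhood (r : ℝ) (V : Set R4) : Prop :=
  ∃ N : Set R4, IsOpen N ∧ Metric.sphere (0 : R4) r ⊆ N ∧ V = N ∩ (Metric.closedBall 0 r)ᶜ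

/-- `V` is an open one-sided neighbourhood of the sphere `S³(r)`. -/
def IsOneSidedNeighbourhood (r : ℝ) (V : Set R4) : Prop :=
  IsInnerNeighbourhood r V ∨ IsOuterNeighbourhood r V

/-- `g` restricts to a symplectomorphism from the open set `V` onto the open set `W`: a smooth
bijection with smooth inverse such that `g^* ω = ω` on `V`. -/
structure IsSymplectomorphism (V W : Set R4) (g : R4 → R4) : Prop where
  bijOn : BijOn g V W
  contDiffOn : ContDiffOn ℝ ∞ g V
  contDiffOn_inverse : ∃ h : R4 → R4, InvOn h g V W ∧ ContDiffOn ℝ ∞ h W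
  pullback_omega : ∀ x ∈ V, ∀ u v : R4,
    omega (fderiv ℝ g x u) (fderiv ℝ g x v) = omega u v

/-- `g x` tends to the sphere `S³(R)` when `x ∈ V` tends to the sphere `S³(r)`. -/
def RespectsSpheres (r R : ℝ) (V : Set R4) (g : R4 → R4) : Prop :=
  Tendsto g (𝓝ˢ (Metric.sphere (0 : R4) r) ⊓ 𝓟 V) (𝓝ˢ (Metric.sphere (0 : R4) R))

end SphereCollar

/-!
The radius is detected by volume. Let `g` be a symplectomorphism on a shell `A` close to `S³(r)`,
and let `θ` be a bump function equal to `1` inside `A` and to `0` outside it, so that `dθ` has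
compact support in `A`. The one-form `d(θ ∘ g⁻¹)`, extended by zero off `g(A)`, is closed on `ℝ⁴`,
so by the Poincaré lemma it has a primitive `H`, normalised to vanish at infinity. This `H` replaces
both the Jordan–Brouwer separation theorem and the degree of `g`. On the connected set `g(A)` it
agrees with `θ ∘ g⁻¹` up to a constant `c`; off the image `K` of the closed shell that carries
`dθ` it is locally constant, and as every component of `Kᶜ` accumulates at `K`, its values there
are `c` and `1 + c` (`mem_of_locally_constant_off`). One of them is the value `0` at infinity, so `c ∈ {0, -1}`.

The integral of `H` does not depend on `g`. As the Euler vector field `E(y) = y` has divergence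
`4`, one has `-4 ∫ H = ∫ dH(E)`, and since `g` preserves volume this is `∫ dθ(g^*E)`. The field
`g^*E - E` is symplectically dual to a closed one-form `α` (twice the difference of the
primitives `g^*λ` and `λ` of `ω`), so `dθ(g^*E - E)` is a sum of components of the compactly
supported closed two-form `dθ ∧ α`. Each component has integral zero because the dimension exceeds
two (`integral_wedge_eq_zero`); exactness of `α` is not needed. Hence `∫ H = ∫ θ > 0`, which forces
`c = 0` and `0 ≤ H ≤ 1` (`exists_filling_function`), while `∫ θ` is close to the volume of `B(r)`.

For inner neighbourhoods, `H` vanishes outside `B(R)`, so `vol B(r) ≤ vol B(R)`, and the inverse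
of `g` gives the converse inequality. If `g` respects the spheres, `K` lies in a thin shell around
`S³(R)` and `H` is constant, equal to `0` or `1`, on a slightly smaller ball. The value `0` would
make `∫ H` arbitrarily small; the value `1` makes `∫ H` close to the volume of `B(R)`.
-/

namespace SphereCollar

open MeasureTheory

theorem two_le_infty : (2 : WithTop ℕ∞) ≤ ∞ := by
  exact WithTop.coe_le_coe.2 (le_top : (2 : ℕ∞) ≤ ⊤)

/-! ### Integration by parts -/

section Integration

variable {E : Type*} [NormedAddCommGroup E] [NormedSpace ℝ E] [MeasurableSpace E] [BorelSpace E]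
  (μ : Measure E) [μ.IsAddHaarMeasure]

theorem integrable_fderiv_apply {f : E → ℝ} (hf : ContDiff ℝ 1 f) (hc : HasCompactSupport f)
    (v : E) : Integrable (fun x ↦ fderiv ℝ f x v) μ :=
  ((hf.continuous_fderiv one_ne_zero).clm_apply continuous_const).integrable_of_hasCompactSupport
    (hc.fderiv_apply ℝ v)

variable [FiniteDimensional ℝ E]

theorem integral_fderiv_apply_eq_zero {f : E → ℝ} (hf : ContDiff ℝ 1 f)
    (hc : HasCompactSupport f) (v : E) : ∫ x, fderiv ℝ f x v ∂μ = 0 := by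
  have h := integral_mul_fderiv_eq_neg_fderiv_mul_of_integrable (μ := μ) (f := fun _ ↦ (1 : ℝ))
    (g := f) (v := v) (by simp) (by simpa using integrable_fderiv_apply μ hf hc v)
    (by simpa using hf.continuous.integrable_of_hasCompactSupport hc)
    (fun x _ ↦ by fun_prop) (fun x _ ↦ hf.differentiable one_ne_zero x)
  simpa using h

/-- A component of the closed, compactly supported two-form `dθ ∧ α` has integral zero as soon as
there is a third coordinate direction `w`: with `ℓ` the corresponding coordinate function, the
component is the divergence of the vector field dual to `ℓ • (dθ ∧ α)` in the directions
`u, v, w`. -/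
theorem integral_wedge_eq_zero {A : Set E} (hA : IsOpen A) {θ : E → ℝ} (hθ : ContDiff ℝ ∞ θ)
    (hθc : HasCompactSupport θ) (hθA : tsupport (fderiv ℝ θ) ⊆ A) {α : E → E →L[ℝ] ℝ}
    (hα : ContDiffOn ℝ ∞ α A)
    (hclosed : ∀ x ∈ A, ∀ u v, fderiv ℝ α x u v = fderiv ℝ α x v u)
    (ℓ : E →L[ℝ] ℝ) (u v w : E) (hu : ℓ u = 0) (hv : ℓ v = 0) (hw : ℓ w = 1) :
    ∫ x, (fderiv ℝ θ x u * α x v - fderiv ℝ θ x v * α x u) ∂μ = 0 := by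
  set S : E → E → E → ℝ := fun u v x ↦ fderiv ℝ θ x u * α x v - fderiv ℝ θ x v * α x u with hS
  have hDθ : ContDiff ℝ ∞ (fderiv ℝ θ) := hθ.fderiv_right (by simp)
  have hoff : ∀ x, x ∉ tsupport (fderiv ℝ θ) → ∀ u v, ∀ᶠ y in 𝓝 x, ℓ y * S u v y = 0 := by
    intro x hx u v
    filter_upwards [notMem_tsupport_iff_eventuallyEq.1 hx] with y hy
    simp [hS, hy]
  have hsub : ∀ u v, tsupport (fun x ↦ ℓ x * S u v x) ⊆ tsupport (fderiv ℝ θ) := by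
    intro u v
    by_contra hcon
    obtain ⟨x, hx, hx'⟩ := not_subset.1 hcon
    exact (notMem_tsupport_iff_eventuallyEq.2 (hoff x hx' u v)) hx
  have hcd : ∀ u v, ContDiff ℝ 1 (fun x ↦ ℓ x * S u v x) := by
    intro u v
    refine contDiff_iff_contDiffAt.2 fun x ↦ ?_
    by_cases hx : x ∈ tsupport (fderiv ℝ θ)
    swap
    · exact contDiffAt_const.congr_of_eventuallyEq (hoff x hx u v)
    have hxA := hθA hx
    have h1 : ContDiffAt ℝ 1 α x := (hα.contDiffAt (hA.mem_nhds hxA)).of_le (by simp)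
    have h2 : ContDiffAt ℝ 1 (fderiv ℝ θ) x := hDθ.contDiffAt.of_le (by simp)
    exact ℓ.contDiff.contDiffAt.mul
      (((h2.clm_apply contDiffAt_const).mul (h1.clm_apply contDiffAt_const)).sub
      ((h2.clm_apply contDiffAt_const).mul (h1.clm_apply contDiffAt_const)))
  have hcs : ∀ u v, HasCompactSupport (fun x ↦ ℓ x * S u v x) := fun u v ↦
    (hθc.fderiv ℝ).of_isClosed_subset (isClosed_tsupport _) (hsub u v)
  have hdiv : ∀ x, S u v x = fderiv ℝ (fun x ↦ ℓ x * S u v x) x w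
      + fderiv ℝ (fun x ↦ ℓ x * S v w x) x u + fderiv ℝ (fun x ↦ ℓ x * S w u x) x v := by
    intro x
    by_cases hx : x ∈ tsupport (fderiv ℝ θ)
    · have hxA := hθA hx
      have h1 : HasFDerivAt α (fderiv ℝ α x) x :=
        ((hα.contDiffAt (hA.mem_nhds hxA)).differentiableAt (by simp)).hasFDerivAt
      have h2 : HasFDerivAt (fderiv ℝ θ) (fderiv ℝ (fderiv ℝ θ) x) x :=
        (hDθ.differentiable (by simp) x).hasFDerivAt
      have h3 : ∀ a b, HasFDerivAt (fun x ↦ ℓ x * S a b x) _ x := fun a b ↦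
        ℓ.hasFDerivAt.mul (((h2.clm_apply (hasFDerivAt_const a x)).mul
          (h1.clm_apply (hasFDerivAt_const b x))).sub
          ((h2.clm_apply (hasFDerivAt_const b x)).mul (h1.clm_apply (hasFDerivAt_const a x))))
      have hsymm : ∀ a b, fderiv ℝ (fderiv ℝ θ) x a b = fderiv ℝ (fderiv ℝ θ) x b a :=
        (hθ.contDiffAt.isSymmSndFDerivAt (by simpa using two_le_infty)).eq
      have hcl := hclosed x hxA
      rw [(h3 u v).fderiv, (h3 v w).fderiv, (h3 w u).fderiv]
      simp [hS, hu, hv, hw]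
      rw [hsymm w u, hsymm w v, hsymm v u, hcl w u, hcl w v, hcl v u]
      ring
    · have h0 : ∀ a b c, fderiv ℝ (fun x ↦ ℓ x * S a b x) x c = 0 := by
        intro a b c
        have : (fun x ↦ ℓ x * S a b x) =ᶠ[𝓝 x] fun _ ↦ (0 : ℝ) := hoff x hx a b
        rw [this.fderiv_eq]
        simp
      have hx0 : fderiv ℝ θ x = 0 := image_eq_zero_of_notMem_tsupport hx
      rw [h0, h0, h0]
      simp only [hS, hx0]
      simp
  have hint := fun a b c ↦ integrable_fderiv_apply μ (hcd a b) (hcs a b) c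
  change ∫ x, S u v x ∂μ = 0
  rw [integral_congr_ae (ae_of_all μ hdiv)]
  have hint2 : Integrable (fun x ↦ fderiv ℝ (fun x ↦ ℓ x * S u v x) x w
      + fderiv ℝ (fun x ↦ ℓ x * S v w x) x u) μ := (hint _ _ _).add (hint _ _ _)
  rw [integral_add hint2 (hint _ _ _), integral_add (hint _ _ _) (hint _ _ _)]
  simp [integral_fderiv_apply_eq_zero μ (hcd _ _) (hcs _ _)]

end Integration

theorem clm_apply_eq_sum (L : R4 →L[ℝ] ℝ) (y : R4) :
    L y = ∑ i, y i * L (EuclideanSpace.single i 1) := by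
  have hy : y = ∑ i, y i • EuclideanSpace.single i (1 : ℝ) := by
    ext j
    simp [Finset.sum_apply, Pi.single_apply]
  conv_lhs => rw [hy, map_sum]
  simp

/-- Integration by parts against the Euler vector field, whose divergence is `4`. -/
theorem integral_fderiv_apply_self {f : R4 → ℝ} (hf : ContDiff ℝ 1 f)
    (hc : HasCompactSupport f) : ∫ x, fderiv ℝ f x x = -4 * ∫ x, f x := by
  set e : Fin 4 → R4 := fun i ↦ EuclideanSpace.single i 1 with he
  have hprod : ∀ i : Fin 4, ContDiff ℝ 1 (fun x : R4 ↦ x i * f x) := fun i ↦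
    (EuclideanSpace.proj (𝕜 := ℝ) i : R4 →L[ℝ] ℝ).contDiff.mul hf
  have hprodc : ∀ i : Fin 4, HasCompactSupport (fun x : R4 ↦ x i * f x) := fun i ↦ hc.mul_left
  have hd : ∀ (i : Fin 4) (x : R4),
      fderiv ℝ (fun x : R4 ↦ x i * f x) x (e i) = f x + x i * fderiv ℝ f x (e i) := by
    intro i x
    have h1 : HasFDerivAt (fun x : R4 ↦ x i) (EuclideanSpace.proj (𝕜 := ℝ) i : R4 →L[ℝ] ℝ) x :=
      (EuclideanSpace.proj (𝕜 := ℝ) i : R4 →L[ℝ] ℝ).hasFDerivAt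
    have h2 : HasFDerivAt (fun x : R4 ↦ x i * f x) _ x :=
      h1.mul (hf.differentiable one_ne_zero x).hasFDerivAt
    rw [h2.fderiv]
    simp [he]
    ring
  have hx : ∀ x : R4, fderiv ℝ f x x = ∑ i, x i * fderiv ℝ f x (e i) := by
    intro x
    exact clm_apply_eq_sum _ x
  have hsum : ∀ x : R4, fderiv ℝ f x x =
      ∑ i, fderiv ℝ (fun x : R4 ↦ x i * f x) x (e i) - 4 * f x := by
    intro x
    simp_rw [hx, hd, Finset.sum_add_distrib]
    simp
  simp_rw [hsum]
  rw [integral_sub, integral_finsetSum]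
  · simp_rw [integral_fderiv_apply_eq_zero _ (hprod _) (hprodc _), integral_const_mul]
    simp
  · exact fun i _ ↦ integrable_fderiv_apply _ (hprod i) (hprodc i) _
  · exact integrable_finsetSum _ fun i _ ↦ integrable_fderiv_apply _ (hprod i) (hprodc i) _
  · exact (hf.continuous.integrable_of_hasCompactSupport hc).const_mul 4

/-! ### Symplectic linear algebra and the pulled back Euler field -/

/-- The symplectic form as a continuous bilinear map. -/
noncomputable def omegaL : R4 →L[ℝ] R4 →L[ℝ] ℝ :=
  let p : Fin 4 → R4 →L[ℝ] ℝ := fun i ↦ EuclideanSpace.proj i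
  (p 0).smulRight (p 1) - (p 1).smulRight (p 0) + ((p 2).smulRight (p 3) - (p 3).smulRight (p 2))

@[simp] theorem omegaL_apply (u v : R4) : omegaL u v = omega u v := by
  simp [omegaL, omega]

theorem abs_det_eq_one_of_preserves_omega {L : R4 →L[ℝ] R4}
    (hL : ∀ u v, omega (L u) (L v) = omega u v) : |L.det| = 1 := by
  set b := (EuclideanSpace.basisFun (Fin 4) ℝ).toBasis with hb
  set M : Matrix (Fin 4) (Fin 4) ℝ := LinearMap.toMatrix b b (L : R4 →ₗ[ℝ] R4) with hM
  set J : Matrix (Fin 4) (Fin 4) ℝ := Matrix.of fun i j ↦ omega (b i) (b j) with hJ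
  have hMij : ∀ i j, M i j = L (b j) i := by
    intro i j
    simp [hM, LinearMap.toMatrix_apply, hb]
  have hJM : M.transpose * J * M = J := by
    ext i j
    have h := hL (b i) (b j)
    simp only [Matrix.mul_apply, Matrix.transpose_apply, Fin.sum_univ_four, hMij]
    rw [hJ]
    simp only [Matrix.of_apply]
    rw [← h]
    simp [omega, hb]
    ring
  have hJdet : J.det = 1 := by
    have : J = !![0, 1, 0, 0; -1, 0, 0, 0; 0, 0, 0, 1; 0, 0, -1, 0] := by
      ext i j
      fin_cases i <;> fin_cases j <;> simp [hJ, omega, hb]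
    rw [this]
    simp [Matrix.det_succ_row_zero, Fin.sum_univ_succ, Fin.succAbove]
  have hdet : L.det = M.det := by
    rw [hM, LinearMap.det_toMatrix]
  have h2 := congrArg Matrix.det hJM
  rw [Matrix.det_mul, Matrix.det_mul, Matrix.det_transpose, hJdet] at h2
  rw [hdet, ← sq_eq_sq₀ (abs_nonneg _) zero_le_one, sq_abs]
  nlinarith

/-- The pull-back `Z` of the Euler vector field by a symplectomorphism, characterised by
`ω(Z, ·) = g^* (ω(E, ·))`, has the same integral against `dθ` as the Euler field itself. -/
theorem integral_fderiv_pullback_euler {A : Set R4} (hA : IsOpen A) {g : R4 → R4}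
    (hg : ContDiffOn ℝ ∞ g A)
    (hω : ∀ x ∈ A, ∀ u v, omega (fderiv ℝ g x u) (fderiv ℝ g x v) = omega u v)
    {θ : R4 → ℝ} (hθ : ContDiff ℝ ∞ θ) (hθc : HasCompactSupport θ)
    (hθA : tsupport (fderiv ℝ θ) ⊆ A) {Z : R4 → R4}
    (hZ : ∀ x ∈ A, ∀ v, omega (Z x) v = omega (g x) (fderiv ℝ g x v)) :
    ∫ x, fderiv ℝ θ x (Z x) = -4 * ∫ x, θ x := by
  set α : R4 → R4 →L[ℝ] ℝ := fun x ↦ (omegaL (g x)).comp (fderiv ℝ g x) - omegaL x with hα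
  have hDg : ContDiffOn ℝ ∞ (fderiv ℝ g) A := hg.fderiv_of_isOpen hA (by simp)
  have hαs : ContDiffOn ℝ ∞ α A :=
    ((omegaL.contDiff.comp_contDiffOn hg).clm_comp hDg).sub omegaL.contDiff.contDiffOn
  have hclosed : ∀ x ∈ A, ∀ u v, fderiv ℝ α x u v = fderiv ℝ α x v u := by
    intro x hx
    have hgx := hg.contDiffAt (hA.mem_nhds hx)
    have h1 : HasFDerivAt g (fderiv ℝ g x) x := (hgx.differentiableAt (by simp)).hasFDerivAt
    have h2 : HasFDerivAt (fderiv ℝ g) (fderiv ℝ (fderiv ℝ g) x) x :=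
      ((hDg.contDiffAt (hA.mem_nhds hx)).differentiableAt (by simp)).hasFDerivAt
    have h3 : HasFDerivAt α _ x :=
      ((omegaL.hasFDerivAt.comp x h1).clm_comp h2).sub omegaL.hasFDerivAt
    have hsymm : ∀ a b, fderiv ℝ (fderiv ℝ g) x a b = fderiv ℝ (fderiv ℝ g) x b a :=
      (hgx.isSymmSndFDerivAt (by simpa using two_le_infty)).eq
    -- The antisymmetric part of the derivative of `α` is `g^* ω - ω`.
    intro u v
    rw [h3.fderiv]
    simp [hω x hx, hsymm u v]
  set e : Fin 4 → R4 := fun i ↦ EuclideanSpace.single i 1 with he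
  -- The fields `Z` and `x` differ by the symplectic dual of `α`, so that `dθ(Z - x)` is the sum of
  -- the components `(0, 1)` and `(2, 3)` of `dθ ∧ α`.
  have hI1 := integral_wedge_eq_zero volume hA hθ hθc hθA hαs hclosed
    (EuclideanSpace.proj (𝕜 := ℝ) 2 : R4 →L[ℝ] ℝ) (e 0) (e 1) (e 2) (by simp [he]) (by simp [he])
    (by simp [he])
  have hI2 := integral_wedge_eq_zero volume hA hθ hθc hθA hαs hclosed
    (EuclideanSpace.proj (𝕜 := ℝ) 0 : R4 →L[ℝ] ℝ) (e 2) (e 3) (e 0) (by simp [he]) (by simp [he])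
    (by simp [he])
  have hpt : ∀ x, fderiv ℝ θ x (Z x) = fderiv ℝ θ x x +
      ((fderiv ℝ θ x (e 0) * α x (e 1) - fderiv ℝ θ x (e 1) * α x (e 0)) +
      (fderiv ℝ θ x (e 2) * α x (e 3) - fderiv ℝ θ x (e 3) * α x (e 2))) := by
    intro x
    by_cases hx : x ∈ tsupport (fderiv ℝ θ)
    · have hαx : ∀ v, α x v = omega (Z x) v - omega x v := by
        intro v
        simp [hα, hZ x (hθA hx)]
      have hsplit : ∀ y : R4, fderiv ℝ θ x y = ∑ i, y i * fderiv ℝ θ x (e i) :=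
        clm_apply_eq_sum _
      rw [hsplit (Z x), hsplit x]
      simp only [hαx, omega, Fin.sum_univ_four]
      simp [he]
      ring
    · simp [image_eq_zero_of_notMem_tsupport hx]
  have hαi : ∀ a b : R4, Integrable fun x ↦ fderiv ℝ θ x a * α x b := by
    intro a b
    refine Continuous.integrable_of_hasCompactSupport ?_ (hθc.fderiv_apply ℝ a).mul_right
    refine continuous_iff_continuousAt.2 fun x ↦ ?_
    by_cases hx : x ∈ tsupport (fderiv ℝ θ)
    · exact ((hθ.continuous_fderiv (by simp)).clm_apply continuous_const).continuousAt.mul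
        ((hαs.continuousOn.continuousAt (hA.mem_nhds (hθA hx))).clm_apply continuousAt_const)
    · refine (continuousAt_const (y := (0 : ℝ))).congr ?_
      filter_upwards [notMem_tsupport_iff_eventuallyEq.1 hx] with y hy
      simp [hy]
  have hself : Integrable fun x ↦ fderiv ℝ θ x x :=
    ((hθ.continuous_fderiv (by simp)).clm_apply continuous_id).integrable_of_hasCompactSupport
      ((hθc.fderiv ℝ).mono fun x hx h0 ↦ hx (by simp [h0]))
  have hwi : ∀ a b : R4,
      Integrable fun x ↦ fderiv ℝ θ x a * α x b - fderiv ℝ θ x b * α x a :=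
    fun a b ↦ (hαi a b).sub (hαi b a)
  have hwi2 : Integrable fun x ↦
      (fderiv ℝ θ x (e 0) * α x (e 1) - fderiv ℝ θ x (e 1) * α x (e 0)) +
      (fderiv ℝ θ x (e 2) * α x (e 3) - fderiv ℝ θ x (e 3) * α x (e 2)) :=
    (hwi _ _).add (hwi _ _)
  simp_rw [hpt]
  rw [integral_add hself hwi2, integral_add (hwi _ _) (hwi _ _), hI1, hI2,
    integral_fderiv_apply_self (hθ.of_le (by simp)) hθc]
  simp

/-! ### Shells and locally constant functions -/

theorem isPreconnected_setOf_norm_mem {s : Set ℝ} (hs : IsPreconnected s) (hpos : s ⊆ Ioi 0) :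
    IsPreconnected {x : R4 | ‖x‖ ∈ s} := by
  have hrank : 1 < Module.rank ℝ R4 := by
    rw [← Module.finrank_eq_rank]
    simp
  have h : {x : R4 | ‖x‖ ∈ s} =
      (fun p : ℝ × R4 ↦ p.1 • p.2) '' (s ×ˢ Metric.sphere (0 : R4) 1) := by
    ext x
    constructor
    · intro hx
      have hx0 : ‖x‖ ≠ 0 := (hpos hx).ne'
      refine ⟨(‖x‖, ‖x‖⁻¹ • x), ⟨hx, ?_⟩, ?_⟩
      · simp [norm_smul, hx0]
      · simp [smul_smul, hx0]
    · rintro ⟨⟨t, u⟩, ⟨ht, hu⟩, rfl⟩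
      have : 0 < t := hpos ht
      have hu1 : ‖u‖ = 1 := by simpa using hu
      simpa [norm_smul, hu1, abs_of_pos this] using ht
  rw [h]
  exact (hs.prod (isPreconnected_sphere hrank 0 1)).image _ (by fun_prop)

/-- A function which is locally constant off `K` takes off `K` only the values it takes on a
neighbourhood of `K`, because every component of `Kᶜ` accumulates at `K`. -/
theorem mem_of_locally_constant_off {X : Type*} [TopologicalSpace X] [PreconnectedSpace X]
    {K U : Set X} (hK : IsClosed K) (hKne : K.Nonempty) (hU : IsOpen U) (hKU : K ⊆ U)
    {H : X → ℝ} (hH : Continuous H) (hloc : ∀ y ∉ K, ∀ᶠ z in 𝓝 y, H z = H y) {T : Set ℝ}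
    (hT : ∀ y ∈ U \ K, H y ∈ T) {y : X} (hy : y ∉ K) : H y ∈ T := by
  by_contra hcon
  set S : Set X := {z | z ∉ K ∧ H z = H y} with hS
  have hopen : IsOpen S := by
    rw [isOpen_iff_mem_nhds]
    rintro z ⟨hz, hzy⟩
    filter_upwards [hK.isOpen_compl.mem_nhds hz, hloc z hz] with w hw hwz
    exact ⟨hw, hwz.trans hzy⟩
  have hclosed : IsClosed S := by
    refine isClosed_of_closure_subset fun z hz ↦ ?_
    have hzy : H z = H y := by
      have : closure S ⊆ {z | H z = H y} :=
        closure_minimal (fun _ h ↦ h.2) (isClosed_eq hH continuous_const)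
      exact this hz
    refine ⟨fun hzK ↦ ?_, hzy⟩
    obtain ⟨w, hwU, hwK, hwy⟩ := mem_closure_iff.1 hz U hU (hKU hzK)
    exact hcon (hwy ▸ hT w ⟨hwU, hwK⟩)
  have huniv : S = univ := IsClopen.eq_univ ⟨hclosed, hopen⟩ ⟨y, hy, rfl⟩
  obtain ⟨k, hk⟩ := hKne
  exact (huniv ▸ mem_univ k : k ∈ S).1 hk

theorem support_fderiv_contDiffBump_subset (f : ContDiffBump (0 : R4)) :
    Function.support (fderiv ℝ f) ⊆ {x | f.rIn ≤ ‖x‖ ∧ ‖x‖ ≤ f.rOut} := by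
  intro x hx
  by_contra hcon
  refine hx ?_
  rw [mem_ofPred_eq, not_and_or, not_le, not_le] at hcon
  rcases hcon with h | h
  · have : (f : R4 → ℝ) =ᶠ[𝓝 x] fun _ ↦ (1 : ℝ) := by
      filter_upwards [Metric.isOpen_ball.mem_nhds (show x ∈ Metric.ball 0 f.rIn by simpa using h)]
        with y hy
      exact f.one_of_mem_closedBall (Metric.ball_subset_closedBall hy)
    rw [this.fderiv_eq]
    simp
  · have : (f : R4 → ℝ) =ᶠ[𝓝 x] fun _ ↦ (0 : ℝ) := by
      filter_upwards [(isOpen_lt continuous_const continuous_norm).mem_nhds h] with y hy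
      exact f.zero_of_le_dist (by simpa using le_of_lt hy)
    rw [this.fderiv_eq]
    simp

theorem isClosed_closedShell (a b : ℝ) : IsClosed {x : R4 | a ≤ ‖x‖ ∧ ‖x‖ ≤ b} :=
  (isClosed_le continuous_const continuous_norm).inter
    (isClosed_le continuous_norm continuous_const)

theorem isCompact_closedShell (a b : ℝ) : IsCompact {x : R4 | a ≤ ‖x‖ ∧ ‖x‖ ≤ b} :=
  (isCompact_closedBall (0 : R4) b).of_isClosed_subset (isClosed_closedShell a b)
    fun x hx ↦ by simpa using hx.2

/-! ### The filling function -/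

/-- The filling function of the image of a shell: it plays the role of `θ ∘ g⁻¹`, continued by `1`
over the region enclosed by the image of the shell and by `0` outside. Its integral is that of
`θ`. -/
theorem exists_filling_function {V W : Set R4} (hV : IsOpen V) (hW : IsOpen W) {g : R4 → R4}
    (hg : IsSymplectomorphism V W g) {a b : ℝ} (ha : 0 < a) (hA : {x : R4 | ‖x‖ ∈ Ioo a b} ⊆ V)
    (θ : ContDiffBump (0 : R4)) (haθ : a < θ.rIn) (hθb : θ.rOut < b) {ρ : ℝ} (hρ : 0 < ρ)
    (hgρ : ∀ x, θ.rIn ≤ ‖x‖ → ‖x‖ ≤ θ.rOut → ‖g x‖ < ρ) :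
    ∃ H : R4 → ℝ, Continuous H ∧ (∀ y, H y ∈ Icc (0 : ℝ) 1) ∧ (∀ y, ρ ≤ ‖y‖ → H y = 0) ∧
      (∀ y, y ∉ g '' {x | θ.rIn ≤ ‖x‖ ∧ ‖x‖ ≤ θ.rOut} → H y ∈ ({0, 1} : Set ℝ)) ∧
      ∫ y, H y = ∫ x, θ x := by
  obtain ⟨h, hinv, hh⟩ := hg.contDiffOn_inverse
  have hgs := hg.contDiffOn
  set A : Set R4 := {x | ‖x‖ ∈ Ioo a b} with hAdef
  set C : Set R4 := {x | θ.rIn ≤ ‖x‖ ∧ ‖x‖ ≤ θ.rOut} with hCdef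
  set K : Set R4 := g '' C with hKdef
  set U : Set R4 := g '' A with hUdef
  have hAo : IsOpen A := isOpen_Ioo.preimage continuous_norm
  have hCA : C ⊆ A := fun x hx ↦ ⟨haθ.trans_le hx.1, hx.2.trans_lt hθb⟩
  have hKU : K ⊆ U := image_mono hCA
  have hKc : IsCompact K :=
    (isCompact_closedShell _ _).image_of_continuousOn (hgs.continuousOn.mono (hCA.trans hA))
  have hUeq : U = W ∩ h ⁻¹' A := by
    ext y
    constructor
    · rintro ⟨x, hx, rfl⟩
      exact ⟨hg.bijOn.mapsTo (hA hx), by simpa [hinv.1 (hA hx)] using hx⟩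
    · rintro ⟨hyW, hyA⟩
      exact ⟨h y, hyA, hinv.2 hyW⟩
  have hUo : IsOpen U := hUeq ▸ hh.continuousOn.isOpen_inter_preimage hW hAo
  have hUW : U ⊆ W := hUeq ▸ inter_subset_left
  have hUpre : IsPreconnected U :=
    (isPreconnected_setOf_norm_mem isPreconnected_Ioo
      (Ioo_subset_Ioi_self.trans (Ioi_subset_Ioi ha.le))).image _ (hgs.continuousOn.mono hA)
  have hKne : K.Nonempty := by
    refine Set.Nonempty.image _ ?_
    refine ⟨EuclideanSpace.single 0 θ.rIn, ?_, ?_⟩ <;>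
    simp [abs_of_pos θ.rIn_pos, θ.rIn_lt_rOut.le]
  have hθs : ContDiff ℝ ∞ θ := θ.contDiff
  have hsuppC : ∀ x, x ∉ C → fderiv ℝ θ x = 0 := fun x hx ↦ by
    by_contra h0
    exact hx (support_fderiv_contDiffBump_subset θ h0)
  have htsC : tsupport (fderiv ℝ θ) ⊆ C :=
    closure_minimal (support_fderiv_contDiffBump_subset θ) (isClosed_closedShell _ _)
  -- The one-form `d(θ ∘ g⁻¹)` vanishes on `U \ K`, hence extends by zero to a closed form on `ℝ⁴`.
  set P : R4 → ℝ := fun y ↦ θ (h y) with hP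
  have hPs : ∀ y ∈ U, ContDiffAt ℝ ∞ P y := fun y hy ↦
    hθs.contDiffAt.comp y (hh.contDiffAt (hW.mem_nhds (hUW hy)))
  have hdP : ∀ y ∈ U, fderiv ℝ P y = (fderiv ℝ θ (h y)).comp (fderiv ℝ h y) := fun y hy ↦
    fderiv_comp y (hθs.differentiable (by simp) _)
      ((hh.contDiffAt (hW.mem_nhds (hUW hy))).differentiableAt (by simp))
  set τ : R4 → R4 →L[ℝ] ℝ := U.indicator (fderiv ℝ P) with hτ
  have hτU : ∀ y ∈ U, τ =ᶠ[𝓝 y] fderiv ℝ P := fun y hy ↦ by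
    filter_upwards [hUo.mem_nhds hy] with z hz
    exact indicator_of_mem hz _
  have hτ0 : ∀ y, y ∉ K → τ y = 0 := by
    intro y hy
    by_cases hyU : y ∈ U
    · rw [hτ, indicator_of_mem hyU, hdP y hyU, hsuppC, ContinuousLinearMap.zero_comp]
      exact fun hC ↦ hy ⟨h y, hC, hinv.2 (hUW hyU)⟩
    · exact indicator_of_notMem hyU _
  have hτK : ∀ y, y ∉ K → τ =ᶠ[𝓝 y] fun _ ↦ 0 := fun y hy ↦ by
    filter_upwards [hKc.isClosed.isOpen_compl.mem_nhds hy] with z hz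
    exact hτ0 z hz
  have hτs : ContDiff ℝ ∞ τ := by
    refine contDiff_iff_contDiffAt.2 fun y ↦ ?_
    by_cases hy : y ∈ K
    · exact ((hPs y (hKU hy)).fderiv_right (by simp)).congr_of_eventuallyEq (hτU y (hKU hy))
    · exact contDiffAt_const.congr_of_eventuallyEq (hτK y hy)
  have hτclosed : ∀ y u v, fderiv ℝ τ y u v = fderiv ℝ τ y v u := by
    intro y u v
    by_cases hy : y ∈ K
    · rw [(hτU y (hKU hy)).fderiv_eq]
      exact ((hPs y (hKU hy)).isSymmSndFDerivAt (by simpa using two_le_infty)).eq u v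
    · rw [(hτK y hy).fderiv_eq]
      simp
  obtain ⟨F, hF⟩ := convex_univ.exists_forall_hasFDerivAt_of_fderiv_symmetric isOpen_univ
    (hτs.differentiable (by simp)).differentiableOn fun y _ ↦ hτclosed y
  replace hF : ∀ y, HasFDerivAt F (τ y) y := fun y ↦ hF y (mem_univ y)
  have hFc : Continuous F := continuous_iff_continuousAt.2 fun y ↦ (hF y).continuousAt
  obtain ⟨c, hc⟩ : ∃ c, ∀ y ∈ U, F y = P y + c := by
    have hd : ∀ y ∈ U, HasFDerivAt (fun z ↦ F z - P z) 0 y := fun y hy ↦ by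
      have := (hF y).sub ((hPs y hy).differentiableAt (by simp)).hasFDerivAt
      rwa [(hτU y hy).eq_of_nhds, sub_self] at this
    obtain ⟨c, hc⟩ := hUo.exists_is_const_of_fderiv_eq_zero hUpre
      (fun y hy ↦ (hd y hy).differentiableAt.differentiableWithinAt) fun y hy ↦ (hd y hy).fderiv
    exact ⟨c, fun y hy ↦ by rw [← hc y hy]; ring⟩
  have hFloc : ∀ y, y ∉ K → ∀ᶠ z in 𝓝 y, F z = F y := by
    intro y hy
    obtain ⟨ε, hε, hball⟩ := Metric.isOpen_iff.1 hKc.isClosed.isOpen_compl y hy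
    filter_upwards [Metric.ball_mem_nhds y hε] with z hz
    exact Metric.isOpen_ball.is_const_of_fderiv_eq_zero (convex_ball y ε).isPreconnected
      (fun w _ ↦ (hF w).differentiableAt.differentiableWithinAt)
      (fun w hw ↦ by rw [(hF w).fderiv, hτ0 w (hball hw)]; rfl) hz (Metric.mem_ball_self hε)
  have hFoff : ∀ y, y ∉ K → F y ∈ ({c, 1 + c} : Set ℝ) := by
    intro y hy
    refine mem_of_locally_constant_off hKc.isClosed hKne hUo hKU hFc hFloc ?_ hy
    rintro z ⟨hzU, hzK⟩
    have hC : h z ∉ C := fun hC ↦ hzK ⟨h z, hC, hinv.2 (hUW hzU)⟩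
    rw [hc z hzU]
    rw [hCdef, mem_ofPred_eq, not_and_or, not_le, not_le] at hC
    rcases hC with hC | hC
    · right
      have : P z = 1 := θ.one_of_mem_closedBall (by simpa using hC.le)
      rw [this, mem_singleton_iff]
    · left
      have : P z = 0 := θ.zero_of_le_dist (by simpa using hC.le)
      rw [this, zero_add]
  have hFrange : ∀ y, F y ∈ Icc c (1 + c) := by
    intro y
    by_cases hy : y ∈ K
    · rw [hc y (hKU hy)]
      exact ⟨by linarith [θ.nonneg (x := h y)], by linarith [θ.le_one (x := h y)]⟩
    · rcases hFoff y hy with h' | h' <;> rw [h'] <;> constructor <;> linarith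
  -- Normalise the primitive to vanish at infinity.
  have hout : {y : R4 | ‖y‖ ∈ Ici ρ} ⊆ Kᶜ := by
    rintro y hy ⟨x, hx, rfl⟩
    exact absurd (hgρ x hx.1 hx.2) (not_lt.2 hy)
  have hfar : EuclideanSpace.single 0 ρ ∈ {y : R4 | ‖y‖ ∈ Ici ρ} := by
    simp [abs_of_pos hρ]
  obtain ⟨d, hdmem, hd⟩ : ∃ d ∈ ({c, 1 + c} : Set ℝ), ∀ y : R4, ρ ≤ ‖y‖ → F y = d := by
    refine ⟨F (EuclideanSpace.single 0 ρ), hFoff _ (hout hfar), fun y hy ↦ ?_⟩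
    exact (isPreconnected_setOf_norm_mem isPreconnected_Ici
      (Ici_subset_Ioi.2 hρ)).constant_of_mapsTo (T := {c, 1 + c})
      (toFinite _).isDiscrete hFc.continuousOn
      (fun z hz ↦ hFoff z (hout hz)) hy hfar
  set H : R4 → ℝ := fun y ↦ F y - d with hH
  have hHd : ∀ y, HasFDerivAt H (τ y) y := fun y ↦ (hF y).sub_const d
  have hHfd : fderiv ℝ H = τ := funext fun y ↦ (hHd y).fderiv
  have hHs : ContDiff ℝ 1 H :=
    contDiff_one_iff_fderiv.2 ⟨fun y ↦ (hHd y).differentiableAt, hHfd ▸ hτs.continuous⟩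
  have hHc : HasCompactSupport H :=
    HasCompactSupport.of_support_subset_isCompact (isCompact_closedBall (0 : R4) ρ) fun y hy ↦ by
      by_contra hcon
      exact hy (by simp [hH, hd y (by simpa using (not_le.1 (by simpa using hcon)).le)])
  -- The integral of `H` is computed by transporting the Euler vector field through `g`.
  have hgh : ∀ x ∈ A, HasFDerivAt g (fderiv ℝ g x) x := fun x hx ↦
    ((hgs.contDiffAt (hV.mem_nhds (hA hx))).differentiableAt (by simp)).hasFDerivAt
  have hcomp : ∀ x ∈ A, ∀ v, fderiv ℝ g x (fderiv ℝ h (g x) v) = v := by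
    intro x hx v
    have hgx : g x ∈ W := hg.bijOn.mapsTo (hA hx)
    have hhg : HasFDerivAt h (fderiv ℝ h (g x)) (g x) :=
      ((hh.contDiffAt (hW.mem_nhds hgx)).differentiableAt (by simp)).hasFDerivAt
    have hgx' : HasFDerivAt g (fderiv ℝ g x) (h (g x)) := by
      rw [hinv.1 (hA hx)]; exact hgh x hx
    have h1 := hgx'.comp (g x) hhg
    have h2 : g ∘ h =ᶠ[𝓝 (g x)] id := by
      filter_upwards [hW.mem_nhds hgx] with z hz
      exact hinv.2 hz
    have h3 := (h1.congr_of_eventuallyEq h2.symm).unique (hasFDerivAt_id (g x))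
    exact congrArg (fun L : R4 →L[ℝ] R4 ↦ L v) h3
  set Z : R4 → R4 := fun x ↦ fderiv ℝ h (g x) (g x) with hZ
  have hpull : ∫ x, fderiv ℝ θ x (Z x) = -4 * ∫ x, θ x := by
    refine integral_fderiv_pullback_euler hAo (hgs.mono hA)
      (fun x hx ↦ hg.pullback_omega x (hA hx)) hθs θ.hasCompactSupport (htsC.trans hCA) ?_
    intro x hx v
    rw [← hg.pullback_omega x (hA hx), hcomp x hx]
  have hchange : ∫ y, fderiv ℝ H y y = ∫ x, fderiv ℝ θ x (Z x) := by
    have h1 : ∫ y, fderiv ℝ H y y = ∫ y in U, fderiv ℝ H y y :=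
      (setIntegral_eq_integral_of_forall_compl_eq_zero fun y hy ↦ by
        rw [hHfd, hτ0 y fun hK ↦ hy (hKU hK)]; rfl).symm
    have h2 : ∫ x, fderiv ℝ θ x (Z x) = ∫ x in A, fderiv ℝ θ x (Z x) :=
      (setIntegral_eq_integral_of_forall_compl_eq_zero fun x hx ↦ by
        rw [hsuppC x fun hC ↦ hx (hCA hC)]; rfl).symm
    rw [h1, h2, hUdef, integral_image_eq_integral_abs_det_fderiv_smul volume hAo.measurableSet
      (fun x hx ↦ (hgh x hx).hasFDerivWithinAt) (hg.bijOn.injOn.mono hA)]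
    refine setIntegral_congr_fun hAo.measurableSet fun x hx ↦ ?_
    have hgU : g x ∈ U := mem_image_of_mem g hx
    simp only [abs_det_eq_one_of_preserves_omega (hg.pullback_omega x (hA hx)), one_smul]
    rw [hHfd, (hτU _ hgU).eq_of_nhds, hdP _ hgU, hinv.1 (hA hx)]
    rfl
  have hint : ∫ y, H y = ∫ x, θ x := by
    have := integral_fderiv_apply_self hHs hHc
    linarith
  have hdc : d = c := by
    rcases hdmem with h' | h'
    · exact h'
    · have hle : ∫ y, H y ≤ 0 := integral_nonpos fun y ↦ by
        have := (hFrange y).2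
        simp only [hH, Pi.zero_apply]
        rw [mem_singleton_iff.1 h']
        linarith
      have hpos : 0 < ∫ x, θ x := θ.integral_pos
      linarith
  refine ⟨H, hHs.continuous, fun y ↦ ?_, fun y hy ↦ by simp [hH, hd y hy], fun y hy ↦ ?_, hint⟩
  · have := hFrange y
    constructor <;> simp only [hH, hdc] <;> linarith [this.1, this.2]
  · rcases hFoff y hy with h' | h'
    · left
      simp [hH, h', hdc]
    · right
      simp [hH, mem_singleton_iff.1 h', hdc]

/-! ### Volumes of balls -/

/-- The volume of the ball of radius `ρ` in `ℝ⁴` is `ρ⁴` times a positive constant. -/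
theorem volume_real_ball {ρ : ℝ} (hρ : 0 ≤ ρ) :
    volume.real (Metric.ball (0 : R4) ρ) = ρ ^ 4 * volume.real (Metric.ball (0 : R4) 1) := by
  rw [measureReal_def, measureReal_def, Measure.addHaar_ball _ _ hρ, ENNReal.toReal_mul,
    ENNReal.toReal_ofReal (by positivity)]
  simp

theorem volume_real_unitBall_pos : 0 < volume.real (Metric.ball (0 : R4) 1) :=
  ENNReal.toReal_pos (Metric.measure_ball_pos _ _ one_pos).ne' measure_ball_lt_top.ne

theorem volume_mul_le_integral {H : R4 → ℝ} (hH : Integrable H) (hH0 : ∀ y, 0 ≤ H y) {ρ : ℝ}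
    (hρ : 0 ≤ ρ) (h1 : ∀ y ∈ Metric.ball (0 : R4) ρ, H y = 1) :
    ρ ^ 4 * volume.real (Metric.ball (0 : R4) 1) ≤ ∫ y, H y := by
  rw [← volume_real_ball hρ, ← integral_indicator_one Metric.isOpen_ball.measurableSet]
  refine integral_mono ((integrable_indicator_iff Metric.isOpen_ball.measurableSet).2
    (integrableOn_const measure_ball_lt_top.ne)) hH fun y ↦ ?_
  by_cases hy : y ∈ Metric.ball (0 : R4) ρ
  · simp [indicator_of_mem hy, h1 y hy]
  · simp [indicator_of_notMem hy, hH0 y]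

theorem integral_le_volume_mul {H : R4 → ℝ} (hH : Integrable H) (hH1 : ∀ y, H y ≤ 1) {ρ : ℝ}
    (hρ : 0 ≤ ρ) (h0 : ∀ y ∉ Metric.ball (0 : R4) ρ, H y = 0) :
    ∫ y, H y ≤ ρ ^ 4 * volume.real (Metric.ball (0 : R4) 1) := by
  rw [← volume_real_ball hρ, ← integral_indicator_one Metric.isOpen_ball.measurableSet]
  refine integral_mono hH ((integrable_indicator_iff Metric.isOpen_ball.measurableSet).2
    (integrableOn_const measure_ball_lt_top.ne)) fun y ↦ ?_
  by_cases hy : y ∈ Metric.ball (0 : R4) ρ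
  · simp [indicator_of_mem hy, hH1 y]
  · simp [indicator_of_notMem hy, h0 y hy]

/-! ### One-sided neighbourhoods and symplectomorphisms -/

theorem IsInnerNeighbourhood.isOpen {r : ℝ} {V : Set R4} (h : IsInnerNeighbourhood r V) :
    IsOpen V := by
  obtain ⟨N, hN, -, rfl⟩ := h
  exact hN.inter Metric.isOpen_ball

theorem IsOneSidedNeighbourhood.isOpen {r : ℝ} {V : Set R4} (h : IsOneSidedNeighbourhood r V) :
    IsOpen V := by
  rcases h with h | ⟨N, hN, -, rfl⟩
  · exact h.isOpen
  · exact hN.inter Metric.isClosed_closedBall.isOpen_compl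

/-- A neighbourhood of a sphere contains all shells close to the sphere. -/
theorem exists_shell_subset {r : ℝ} (hr : 0 < r) {N : Set R4}
    (hN : N ∈ 𝓝ˢ (Metric.sphere (0 : R4) r)) :
    ∃ ε > 0, ∀ x : R4, |‖x‖ - r| < ε → x ∈ N := by
  obtain ⟨O, hO, hsO, hON⟩ := mem_nhdsSet_iff_exists.1 hN
  obtain ⟨ε, hε, hthick⟩ := (isCompact_sphere (0 : R4) r).exists_thickening_subset_open hO hsO
  refine ⟨min ε r, lt_min hε hr, fun x hx ↦ hON (hthick (Metric.mem_thickening_iff.2 ?_))⟩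
  have hx0 : 0 < ‖x‖ := by
    have := (abs_lt.1 (hx.trans_le (min_le_right _ _))).1
    linarith
  refine ⟨(r / ‖x‖) • x, ?_, ?_⟩
  · simp [norm_smul, abs_of_pos hr, hx0.ne']
  · have h1 : x - (r / ‖x‖) • x = ((‖x‖ - r) / ‖x‖) • x := by
      rw [sub_div, div_self hx0.ne', sub_smul, one_smul]
    rw [dist_eq_norm, h1, norm_smul, Real.norm_eq_abs, abs_div, abs_norm,
      div_mul_cancel₀ _ hx0.ne']
    exact hx.trans_le (min_le_left _ _)

theorem IsInnerNeighbourhood.exists_shell_subset {r : ℝ} (hr : 0 < r) {V : Set R4}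
    (h : IsInnerNeighbourhood r V) :
    ∃ ε > 0, ∀ x : R4, ‖x‖ ∈ Ioo (r - ε) r → x ∈ V := by
  obtain ⟨N, hN, hs, rfl⟩ := h
  obtain ⟨ε, hε, hsub⟩ := SphereCollar.exists_shell_subset hr (hN.mem_nhdsSet.2 hs)
  refine ⟨ε, hε, fun x hx ↦ ⟨hsub x (abs_lt.2 ⟨?_, ?_⟩), by simpa using hx.2⟩⟩ <;>
    linarith [hx.1, hx.2]

theorem IsOuterNeighbourhood.exists_shell_subset {r : ℝ} (hr : 0 < r) {V : Set R4}
    (h : IsOuterNeighbourhood r V) :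
    ∃ ε > 0, ∀ x : R4, ‖x‖ ∈ Ioo r (r + ε) → x ∈ V := by
  obtain ⟨N, hN, hs, rfl⟩ := h
  obtain ⟨ε, hε, hsub⟩ := SphereCollar.exists_shell_subset hr (hN.mem_nhdsSet.2 hs)
  refine ⟨ε, hε, fun x hx ↦ ⟨hsub x (abs_lt.2 ⟨?_, ?_⟩), by simpa using hx.1⟩⟩ <;>
    linarith [hx.1, hx.2]

theorem IsOneSidedNeighbourhood.exists_shell_subset {r : ℝ} (hr : 0 < r) {V : Set R4}
    (h : IsOneSidedNeighbourhood r V) {δ : ℝ} (hδ : 0 < δ) :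
    ∃ a b, 0 < a ∧ a < b ∧ r - δ < a ∧ b < r + δ ∧ ∀ x : R4, ‖x‖ ∈ Ioo a b → x ∈ V := by
  rcases h with h | h
  · obtain ⟨ε, hε, hsub⟩ := h.exists_shell_subset hr
    have hm : 0 < min (min ε δ) r := lt_min (lt_min hε hδ) hr
    have h1 : min (min ε δ) r ≤ ε := (min_le_left _ _).trans (min_le_left _ _)
    have h2 : min (min ε δ) r ≤ δ := (min_le_left _ _).trans (min_le_right _ _)
    have h3 : min (min ε δ) r ≤ r := min_le_right _ _
    exact ⟨r - min (min ε δ) r / 2, r, by linarith, by linarith, by linarith, by linarith,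
      fun x hx ↦ hsub x ⟨by linarith [hx.1], hx.2⟩⟩
  · obtain ⟨ε, hε, hsub⟩ := h.exists_shell_subset hr
    have hm : 0 < min ε δ := lt_min hε hδ
    have h1 : min ε δ ≤ ε := min_le_left _ _
    have h2 : min ε δ ≤ δ := min_le_right _ _
    exact ⟨r, r + min ε δ / 2, hr, by linarith, by linarith, by linarith,
      fun x hx ↦ hsub x ⟨hx.1, by linarith [hx.2]⟩⟩

theorem IsSymplectomorphism.exists_inverse {V W : Set R4} (hV : IsOpen V) (hW : IsOpen W)
    {g : R4 → R4} (hg : IsSymplectomorphism V W g) : ∃ h, IsSymplectomorphism W V h := by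
  obtain ⟨h, hinv, hh⟩ := hg.contDiffOn_inverse
  refine ⟨h, hg.bijOn.symm hinv.symm, hh, ⟨g, hinv.symm, hg.contDiffOn⟩, fun y hy u v ↦ ?_⟩
  have hhV : h y ∈ V := (hg.bijOn.symm hinv.symm).mapsTo hy
  have h1 : HasFDerivAt g (fderiv ℝ g (h y)) (h y) :=
    ((hg.contDiffOn.contDiffAt (hV.mem_nhds hhV)).differentiableAt (by simp)).hasFDerivAt
  have h2 : HasFDerivAt h (fderiv ℝ h y) y :=
    ((hh.contDiffAt (hW.mem_nhds hy)).differentiableAt (by simp)).hasFDerivAt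
  have h3 : g ∘ h =ᶠ[𝓝 y] id := by
    filter_upwards [hW.mem_nhds hy] with z hz
    exact hinv.2 hz
  have h4 := ((h1.comp y h2).congr_of_eventuallyEq h3.symm).unique (hasFDerivAt_id y)
  have h5 : ∀ w, fderiv ℝ g (h y) (fderiv ℝ h y w) = w := fun w ↦
    congrArg (fun L : R4 →L[ℝ] R4 ↦ L w) h4
  rw [← hg.pullback_omega _ hhV, h5, h5]

/-! ### Comparison of the radii -/

/-- A symplectomorphism between inner neighbourhoods cannot decrease the radius: the image of a
sphere of radius close to `r` encloses the same volume as that sphere, inside the ball of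
radius `R`. -/
theorem le_of_isSymplectomorphism_inner {r R : ℝ} (hr : 0 < r) (hR : 0 < R) {V W : Set R4}
    {g : R4 → R4} (hV : IsInnerNeighbourhood r V) (hW : IsInnerNeighbourhood R W)
    (hg : IsSymplectomorphism V W g) : r ≤ R := by
  refine le_of_forall_lt_imp_le_of_dense fun s hs ↦ ?_
  obtain ⟨ε, hε, hsub⟩ := hV.exists_shell_subset hr
  obtain ⟨a, ha, har⟩ := exists_between
    (show max (max s (r - ε)) 0 < r from max_lt (max_lt hs (by linarith)) hr)
  obtain ⟨t₁, hat, htr⟩ := exists_between har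
  obtain ⟨t₂, htt, htr'⟩ := exists_between htr
  have hsa : s < a := ((le_max_left _ _).trans (le_max_left _ _)).trans_lt ha
  have hea : r - ε < a := ((le_max_right _ _).trans (le_max_left _ _)).trans_lt ha
  have h0a : 0 < a := (le_max_right _ _).trans_lt ha
  have hA : {x : R4 | ‖x‖ ∈ Ioo a r} ⊆ V := fun x hx ↦ hsub x ⟨hea.trans hx.1, hx.2⟩
  let θ : ContDiffBump (0 : R4) := ⟨t₁, t₂, h0a.trans hat, htt⟩
  obtain ⟨H, hHc, hH01, hHout, -, hint⟩ := exists_filling_function hV.isOpen hW.isOpen hg h0a hA θ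
    hat htr' hR fun x hx₁ hx₂ ↦ by
      have hgW := hg.bijOn.mapsTo (hA ⟨hat.trans_le hx₁, lt_of_le_of_lt hx₂ htr'⟩)
      obtain ⟨N, -, -, rfl⟩ := hW
      simpa using hgW.2
  have hHi : Integrable H := hHc.integrable_of_hasCompactSupport
    (HasCompactSupport.of_support_subset_isCompact (isCompact_closedBall (0 : R4) R) fun y hy ↦ by
      by_contra hcon
      exact hy (hHout y (not_le.1 (by simpa using hcon)).le))
  have hle := (volume_mul_le_integral θ.integrable (fun y ↦ θ.nonneg) (h0a.trans hat).le
    fun y hy ↦ θ.one_of_mem_closedBall (Metric.ball_subset_closedBall hy)).trans (hint.symm.trans_le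
    (integral_le_volume_mul hHi (fun y ↦ (hH01 y).2) hR.le fun y hy ↦ hHout y (by simpa using hy)))
  have h4 : t₁ ^ 4 ≤ R ^ 4 := le_of_mul_le_mul_right hle volume_real_unitBall_pos
  have : t₁ ≤ R := le_of_pow_le_pow_left₀ (by norm_num) hR.le h4
  linarith

/-- The volume enclosed by the image of a sphere close to `S³(r)`, compared with the balls between
which this image lies. In the second alternative the image does not enclose the smaller ball. -/
theorem radii_close_or_volume_small {r R : ℝ} (hr : 0 < r) {V W : Set R4}
    {g : R4 → R4} (hV : IsOneSidedNeighbourhood r V) (hW : IsOneSidedNeighbourhood R W)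
    (hg : IsSymplectomorphism V W g) (hgs : RespectsSpheres r R V g) {δ : ℝ} (hδ : 0 < δ)
    (hδr : δ < r) (hδR : δ < R) :
    (R - δ ≤ r + δ ∧ r - δ ≤ R + δ) ∨ (r - δ) ^ 4 ≤ (R + δ) ^ 4 - (R - δ) ^ 4 := by
  have hR : 0 < R := hδ.trans hδR
  have hnear : {y : R4 | |‖y‖ - R| < δ} ∈ 𝓝ˢ (Metric.sphere (0 : R4) R) := by
    refine (isOpen_lt (by fun_prop) continuous_const).mem_nhdsSet.2 fun y hy ↦ ?_
    have : ‖y‖ = R := by simpa using hy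
    simpa [this] using hδ
  obtain ⟨ε, hε, hεM⟩ := exists_shell_subset hr (mem_inf_principal.1 (hgs hnear))
  obtain ⟨a, b, h0a, hab, har, hbr, hA⟩ := hV.exists_shell_subset hr (lt_min hε hδ)
  have hεl := min_le_left ε δ
  have hεr := min_le_right ε δ
  obtain ⟨t₁, hat, htb⟩ := exists_between hab
  obtain ⟨t₂, htt, htb'⟩ := exists_between htb
  let θ : ContDiffBump (0 : R4) := ⟨t₁, t₂, h0a.trans hat, htt⟩
  have hg' : ∀ x : R4, t₁ ≤ ‖x‖ → ‖x‖ ≤ t₂ → |‖g x‖ - R| < δ := fun x hx₁ hx₂ ↦ by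
    refine hεM x (abs_lt.2 ⟨?_, ?_⟩) (hA x ⟨?_, ?_⟩) <;> linarith
  obtain ⟨H, hHc, hH01, hHout, hHoff, hint⟩ := exists_filling_function hV.isOpen hW.isOpen hg h0a
    hA θ hat htb' (by linarith : 0 < R + δ) fun x hx₁ hx₂ ↦ by
      linarith [(abs_lt.1 (hg' x hx₁ hx₂)).2]
  have hHi : Integrable H := hHc.integrable_of_hasCompactSupport
    (HasCompactSupport.of_support_subset_isCompact (isCompact_closedBall (0 : R4) (R + δ))
      fun y hy ↦ by
        by_contra hcon
        exact hy (hHout y (not_le.1 (by simpa using hcon)).le))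
  have hvol := volume_real_unitBall_pos
  have hlow : (r - δ) ^ 4 * volume.real (Metric.ball (0 : R4) 1) ≤ ∫ y, H y := by
    rw [hint]
    exact volume_mul_le_integral θ.integrable (fun y ↦ θ.nonneg) (by linarith) fun y hy ↦
      θ.one_of_mem_closedBall (Metric.closedBall_subset_closedBall
        (by change r - δ ≤ t₁; linarith) (Metric.ball_subset_closedBall hy))
  have hup : ∫ y, H y ≤ (R + δ) ^ 4 * volume.real (Metric.ball (0 : R4) 1) :=
    integral_le_volume_mul hHi (fun y ↦ (hH01 y).2) (by linarith) fun y hy ↦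
      hHout y (by simpa using hy)
  have hup' : ∫ y, H y ≤ (r + δ) ^ 4 * volume.real (Metric.ball (0 : R4) 1) := by
    rw [hint]
    refine integral_le_volume_mul θ.integrable (fun y ↦ θ.le_one) (by linarith) fun y hy ↦
      θ.zero_of_le_dist ?_
    have : r + δ ≤ dist y 0 := by simpa using hy
    change t₂ ≤ dist y 0
    linarith
  have hball : ∀ y ∈ Metric.ball (0 : R4) (R - δ), H y ∈ ({0, 1} : Set ℝ) := fun y hy ↦
    hHoff y <| by
      rintro ⟨x, hx, rfl⟩
      have h1 := (abs_lt.1 (hg' x hx.1 hx.2)).1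
      have h2 : ‖g x‖ < R - δ := by simpa using hy
      linarith
  have hconst : ∀ y ∈ Metric.ball (0 : R4) (R - δ), H y = H 0 := fun y hy ↦ by
    exact (convex_ball (0 : R4) (R - δ)).isPreconnected.constant_of_mapsTo
      (toFinite _).isDiscrete hHc.continuousOn hball hy (Metric.mem_ball_self (by linarith))
  rcases hball 0 (Metric.mem_ball_self (by linarith)) with h0 | h1
  · right
    -- `H + 1_{B(R - δ)}` is still bounded by the indicator of `B(R + δ)`.
    have hi : Integrable ((Metric.ball (0 : R4) (R - δ)).indicator (1 : R4 → ℝ)) :=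
      (integrable_indicator_iff Metric.isOpen_ball.measurableSet).2
        (integrableOn_const measure_ball_lt_top.ne)
    have hsum : ∫ y, (H y + (Metric.ball (0 : R4) (R - δ)).indicator (1 : R4 → ℝ) y) ≤
        (R + δ) ^ 4 * volume.real (Metric.ball (0 : R4) 1) := by
      refine integral_le_volume_mul (hHi.add hi) (fun y ↦ ?_) (by linarith) fun y hy ↦ ?_
      · by_cases hy : y ∈ Metric.ball (0 : R4) (R - δ)
        · simp [indicator_of_mem hy, hconst y hy, h0]
        · simpa [indicator_of_notMem hy] using (hH01 y).2
      · have hy' : R + δ ≤ ‖y‖ := by simpa using hy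
        rw [Pi.add_apply, hHout y hy', indicator_of_notMem (by simp; linarith), add_zero]
    rw [integral_add hHi hi, integral_indicator_one Metric.isOpen_ball.measurableSet,
      volume_real_ball (by linarith)] at hsum
    refine le_of_mul_le_mul_right ?_ hvol
    linarith
  · left
    have hlow' : (R - δ) ^ 4 * volume.real (Metric.ball (0 : R4) 1) ≤ ∫ y, H y :=
      volume_mul_le_integral hHi (fun y ↦ (hH01 y).1) (by linarith) fun y hy ↦
        (hconst y hy).trans h1
    exact ⟨le_of_pow_le_pow_left₀ (by norm_num) (by linarith)
        (le_of_mul_le_mul_right (hlow'.trans hup') hvol),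
      le_of_pow_le_pow_left₀ (by norm_num) (by linarith)
        (le_of_mul_le_mul_right (hlow.trans hup) hvol)⟩

theorem eq_of_isSymplectomorphism_oneSided {r R : ℝ} (hr : 0 < r) (hR : 0 < R) {V W : Set R4}
    {g : R4 → R4} (hV : IsOneSidedNeighbourhood r V) (hW : IsOneSidedNeighbourhood R W)
    (hg : IsSymplectomorphism V W g) (hgs : RespectsSpheres r R V g) : r = R := by
  by_contra hne
  have habs : 0 < |r - R| := abs_pos.2 (sub_ne_zero.2 hne)
  have hlim : ∀ᶠ δ in 𝓝[>] (0 : ℝ), (R + δ) ^ 4 - (R - δ) ^ 4 < (r - δ) ^ 4 := by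
    refine nhdsWithin_le_nhds (ContinuousAt.eventually_lt (by fun_prop) (by fun_prop) ?_)
    simpa using pow_pos hr 4
  have hsmall : ∀ c > 0, ∀ᶠ δ in 𝓝[>] (0 : ℝ), δ < c := fun c hc ↦
    nhdsWithin_le_nhds (gt_mem_nhds hc)
  obtain ⟨δ, h1, h2, h3, h4, h0⟩ := (hlim.and ((hsmall r hr).and ((hsmall R hR).and
    ((hsmall (|r - R| / 2) (by linarith)).and self_mem_nhdsWithin)))).exists
  rcases radii_close_or_volume_small hr hV hW hg hgs h0 h2 h3 with ⟨h5, h6⟩ | h5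
  · have : |r - R| ≤ 2 * δ := abs_le.2 ⟨by linarith, by linarith⟩
    linarith
  · linarith

theorem isInnerNeighbourhood_ball (r : ℝ) : IsInnerNeighbourhood r (Metric.ball 0 r) :=
  ⟨univ, isOpen_univ, subset_univ _, by simp⟩

theorem isSymplectomorphism_id (V : Set R4) : IsSymplectomorphism V V id where
  bijOn := bijOn_id V
  contDiffOn := contDiffOn_id
  contDiffOn_inverse := ⟨id, ⟨fun _ _ ↦ rfl, fun _ _ ↦ rfl⟩, contDiffOn_id⟩
  pullback_omega := by simp

end SphereCollar

theorem mainTheorem6 (r R : ℝ) (hr : 0 < r) (hR : 0 < R) :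
    ((∃ (V W : Set SphereCollar.R4) (g : SphereCollar.R4 → SphereCollar.R4),
        SphereCollar.IsInnerNeighbourhood r V ∧ SphereCollar.IsInnerNeighbourhood R W ∧
          SphereCollar.IsSymplectomorphism V W g) ↔ r = R) ∧
    ((∃ (V W : Set SphereCollar.R4) (g : SphereCollar.R4 → SphereCollar.R4),
        SphereCollar.IsOneSidedNeighbourhood r V ∧ SphereCollar.IsOneSidedNeighbourhood R W ∧
          SphereCollar.IsSymplectomorphism V W g ∧
          SphereCollar.RespectsSpheres r R V g) ↔ r = R) := by
  refine ⟨⟨?_, ?_⟩, ⟨?_, ?_⟩⟩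
  · rintro ⟨V, W, g, hV, hW, hg⟩
    obtain ⟨h, hh⟩ := hg.exists_inverse hV.isOpen hW.isOpen
    exact le_antisymm (SphereCollar.le_of_isSymplectomorphism_inner hr hR hV hW hg)
      (SphereCollar.le_of_isSymplectomorphism_inner hR hr hW hV hh)
  · rintro rfl
    exact ⟨_, _, id, SphereCollar.isInnerNeighbourhood_ball r,
      SphereCollar.isInnerNeighbourhood_ball r, SphereCollar.isSymplectomorphism_id _⟩
  · rintro ⟨V, W, g, hV, hW, hg, hgs⟩
    exact SphereCollar.eq_of_isSymplectomorphism_oneSided hr hR hV hW hg hgs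
  · rintro rfl
    exact ⟨_, _, id, Or.inl (SphereCollar.isInnerNeighbourhood_ball r),
      Or.inl (SphereCollar.isInnerNeighbourhood_ball r), SphereCollar.isSymplectomorphism_id _,
      tendsto_id.mono_left inf_le_left⟩
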